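/- For a two-qubit unit vector $|\psi\rangle$ with reduced state $\rho_r$ on one qubit, let $C(\psi)=\sqrt{2(1-\mathrm{Tr}\,\rho_r^2)}$ be its concurrence and $E(\psi)=-\mathrm{Tr}\,\rho_r\log_2\rho_r$ its entropy of entanglement. For a two-qubit mixed state $\rho$, let the concurrence $C(\rho)$ and the entanglement of formation $E_F(\rho)$ be the convex roofs of these functions, i.e. the infimum of $\sum_i p_i C(\psi_i)$, respectively $\sum_i p_i E(\psi_i)$, over all finite decompositions $\rho=\sum_i p_i|\psi_i\rangle\langle\psi_i|$ into pure states. Theorem. Let $\rho_{12}$ and $\rho_{34}$ be two-qubit states. Alice holds qubit $1$, Sapna holds qubits $2$ and $3$, and Bob holds qubit $4$, in the joint state $\rho_{12}\otimes\rho_{34}$. The three parties perform an LOCC protocol: finitely many rounds, in each of which one party performs a measurement with finitely many outcomes on her or his own finite-dimensional system (whose dimension may change), given by Kraus operators $K_i$ with $\sum_i K_i^\dagger K_i=I$, and broadcasts the outcome; the choice of all later steps may depend on it, and outcomes may be forgotten. In the end Alice and Bob hold one qubit each and Sapna's system is discarded. If the protocol has the outcomes $j=1,\dots,s$, where outcome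 $j$ occurs with probability $Q_j$ and leaves Alice and Bob with the two-qubit state $\sigma_{14}^j$, then $$\sum_{j=1}^s Q_j\,C(\sigma_{14}^j)\;\le\;C(\rho_{12})\,C(\rho_{34}),$$ and the average entanglement of formation created is bounded by the same number: $$\sum_{j=1}^s Q_j\,E_F(\sigma_{14}^j)\;\le\;C(\rho_{12})\,C(\rho_{34}).$$ -/

import Mathlib

open scoped Kronecker ComplexOrder Matrix

/-- Operators on two qubits, in the computational basis. -/
abbrev TwoQubitOp : Type := Matrix (Fin 2 × Fin 2) (Fin 2 × Fin 2) ℂ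

/-- Density operators of two qubits. -/
def IsTwoQubitState (ρ : TwoQubitOp) : Prop :=
  ρ.PosSemidef ∧ ρ.trace = 1

/-- Unit vectors of two qubits. -/
def IsUnitVector (ψ : Fin 2 × Fin 2 → ℂ) : Prop :=
  ∑ x, ‖ψ x‖ ^ 2 = 1

/-- The reduced operator of `|ψ⟩⟨ψ|` on the first qubit. -/
def reducedOp (ψ : Fin 2 × Fin 2 → ℂ) : Matrix (Fin 2) (Fin 2) ℂ :=
  Matrix.of fun i i' => ∑ k, ψ (i, k) * star (ψ (i', k))

theorem reducedOp_isHermitian (ψ : Fin 2 × Fin 2 → ℂ) : (reducedOp ψ).IsHermitian := by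
  ext i j
  simp [reducedOp, Matrix.conjTranspose_apply, mul_comm]

/-- The concurrence `√(2 (1 - Tr ρ_r²))` of a two-qubit unit vector. -/
noncomputable def pureConcurrence (ψ : Fin 2 × Fin 2 → ℂ) : ℝ :=
  Real.sqrt (2 * (1 - ((reducedOp ψ * reducedOp ψ).trace).re))

/-- The entropy of entanglement `- Tr (ρ_r log₂ ρ_r)` of a two-qubit unit vector. -/
noncomputable def pureEntanglement (ψ : Fin 2 × Fin 2 → ℂ) : ℝ :=
  (∑ i, Real.negMulLog ((reducedOp_isHermitian ψ).eigenvalues i)) / Real.log 2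

/-- The convex roof of a function `f` of unit vectors: the infimum of the averages
`∑ pᵢ f(ψᵢ)` over all finite decompositions `ρ = ∑ pᵢ |ψᵢ⟩⟨ψᵢ|` into pure states. -/
noncomputable def convexRoof (f : (Fin 2 × Fin 2 → ℂ) → ℝ) (ρ : TwoQubitOp) : ℝ :=
  sInf {x : ℝ | ∃ (n : ℕ) (p : Fin n → ℝ) (ψ : Fin n → Fin 2 × Fin 2 → ℂ),
    (∀ i, 0 ≤ p i) ∧ ∑ i, p i = 1 ∧ (∀ i, IsUnitVector (ψ i)) ∧
    ρ = ∑ i, (p i : ℂ) • Matrix.vecMulVec (ψ i) (star (ψ i)) ∧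
    x = ∑ i, p i * f (ψ i)}

/-- The concurrence of a two-qubit state. -/
noncomputable def concurrence (ρ : TwoQubitOp) : ℝ := convexRoof pureConcurrence ρ

/-- The entanglement of formation of a two-qubit state, in ebits. -/
noncomputable def entanglementOfFormation (ρ : TwoQubitOp) : ℝ :=
  convexRoof pureEntanglement ρ

/-- Operators on the joint system of Alice (dimension `a`), Sapna (dimension `s`) and
Bob (dimension `b`). -/
abbrev JointOp (a s b : ℕ) : Type :=
  Matrix (Fin a × Fin s × Fin b) (Fin a × Fin s × Fin b) ℂ

/-- The state `ρ₁₂ ⊗ ρ₃₄`, where Alice holds qubit 1, Sapna the qubits 2 and 3 and Bob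
qubit 4; Sapna's two qubits are one system of dimension `2 * 2`. -/
def initialState (ρ₁₂ ρ₃₄ : TwoQubitOp) : JointOp 2 (2 * 2) 2 :=
  Matrix.of fun x y =>
    ρ₁₂ (x.1, (finProdFinEquiv.symm x.2.1).1) (y.1, (finProdFinEquiv.symm y.2.1).1) *
      ρ₃₄ ((finProdFinEquiv.symm x.2.1).2, x.2.2) ((finProdFinEquiv.symm y.2.1).2, y.2.2)

/-- The operator `σ₁₄ = Tr_Sapna σ` that remains when Sapna's system is discarded. -/
def traceSapna {s : ℕ} (ρ : JointOp 2 s 2) : TwoQubitOp :=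
  Matrix.of fun x y => ∑ k, ρ (x.1, k, x.2) (y.1, k, y.2)

/-- LOCC protocols of the three parties, with outcome labels in `Fin m`, that start with
local systems of dimensions `a` (Alice), `s` (Sapna), `b` (Bob).

In each step one party performs a measurement on her or his own system, with Kraus operators
`K i` and `∑ (K i)ᴴ * K i = 1`, and broadcasts the outcome `i`; the remaining protocol may
depend on `i`, hence on all earlier outcomes. The local dimension may change with
each step (local ancillas and discarded subsystems). A protocol ends when Alice and Bob
hold one qubit each, and the finished branch carries a label. Several branches may carry the same
label: this is how outcomes are forgotten, so that operations with several Kraus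
operators per reported outcome are included. -/
inductive LOCC (m : ℕ) : ℕ → ℕ → ℕ → Type
  | done {s : ℕ} (j : Fin m) : LOCC m 2 s 2
  | alice {a s b : ℕ} (n : ℕ) (d : Fin n → ℕ)
      (K : (i : Fin n) → Matrix (Fin (d i)) (Fin a) ℂ)
      (hK : ∑ i, (K i)ᴴ * K i = 1)
      (next : (i : Fin n) → LOCC m (d i) s b) : LOCC m a s b
  | sapna {a s b : ℕ} (n : ℕ) (d : Fin n → ℕ)
      (K : (i : Fin n) → Matrix (Fin (d i)) (Fin s) ℂ)
      (hK : ∑ i, (K i)ᴴ * K i = 1)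
      (next : (i : Fin n) → LOCC m a (d i) b) : LOCC m a s b
  | bob {a s b : ℕ} (n : ℕ) (d : Fin n → ℕ)
      (K : (i : Fin n) → Matrix (Fin (d i)) (Fin b) ℂ)
      (hK : ∑ i, (K i)ᴴ * K i = 1)
      (next : (i : Fin n) → LOCC m a s (d i)) : LOCC m a s b

/-- Action of a local operator of Alice on the joint system. -/
noncomputable def onAlice {a a' s b : ℕ} (K : Matrix (Fin a') (Fin a) ℂ) (ρ : JointOp a s b) :
    JointOp a' s b :=
  (K ⊗ₖ ((1 : Matrix (Fin s) (Fin s) ℂ) ⊗ₖ (1 : Matrix (Fin b) (Fin b) ℂ))) * ρ *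
    (K ⊗ₖ ((1 : Matrix (Fin s) (Fin s) ℂ) ⊗ₖ (1 : Matrix (Fin b) (Fin b) ℂ)))ᴴ

/-- Action of a local operator of Sapna on the joint system. -/
noncomputable def onSapna {a s s' b : ℕ} (K : Matrix (Fin s') (Fin s) ℂ) (ρ : JointOp a s b) :
    JointOp a s' b :=
  ((1 : Matrix (Fin a) (Fin a) ℂ) ⊗ₖ (K ⊗ₖ (1 : Matrix (Fin b) (Fin b) ℂ))) * ρ *
    ((1 : Matrix (Fin a) (Fin a) ℂ) ⊗ₖ (K ⊗ₖ (1 : Matrix (Fin b) (Fin b) ℂ)))ᴴ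

/-- Action of a local operator of Bob on the joint system. -/
noncomputable def onBob {a s b b' : ℕ} (K : Matrix (Fin b') (Fin b) ℂ) (ρ : JointOp a s b) :
    JointOp a s b' :=
  ((1 : Matrix (Fin a) (Fin a) ℂ) ⊗ₖ ((1 : Matrix (Fin s) (Fin s) ℂ) ⊗ₖ K)) * ρ *
    ((1 : Matrix (Fin a) (Fin a) ℂ) ⊗ₖ ((1 : Matrix (Fin s) (Fin s) ℂ) ⊗ₖ K))ᴴ

/-- The unnormalized operator `Q_j σ₁₄^j` that Alice and Bob share when a protocol, run on the
joint state `ρ`, ends with the label `j`: the sum over all branches with this label. -/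
noncomputable def LOCC.output {m : ℕ} :
    {a s b : ℕ} → LOCC m a s b → JointOp a s b → Fin m → TwoQubitOp
  | _, _, _, .done j₀, ρ, j => if j = j₀ then traceSapna ρ else 0
  | _, _, _, .alice _ _ K _ next, ρ, j => ∑ i, (next i).output (onAlice (K i) ρ) j
  | _, _, _, .sapna _ _ K _ next, ρ, j => ∑ i, (next i).output (onSapna (K i) ρ) j
  | _, _, _, .bob _ _ K _ next, ρ, j => ∑ i, (next i).output (onBob (K i) ρ) j

/-- The probability `Q_j` of the outcome `j`. -/
noncomputable def LOCC.prob {m a s b : ℕ} (P : LOCC m a s b) (ρ : JointOp a s b) (j : Fin m) : ℝ :=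
  (P.output ρ j).trace.re

/-- The state `σ₁₄^j` of Alice and Bob after the outcome `j` (meaningful if `Q_j ≠ 0`). -/
noncomputable def LOCC.outcome {m a s b : ℕ} (P : LOCC m a s b) (ρ : JointOp a s b)
    (j : Fin m) : TwoQubitOp :=
  ((P.prob ρ j : ℂ))⁻¹ • P.output ρ j

/-!
For a pure two-qubit vector with `2 × 2` amplitude matrix `M` the concurrence is `2 |det M|`
(`pureConcurrence_eq_vectorConcurrence`). This makes sense, and is homogeneous of degree two, for
unnormalized vectors, so the weights of an ensemble can be absorbed into its vectors
(`HasEnsemble`).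

Let the input be `|ψ⟩ ⊗ |φ⟩`. Along a branch of the protocol Alice, Sapna and Bob have applied
operators `A`, `S`, `B`. If Sapna's discarded system is resolved in a basis, with `X k` the
`k`-th row of `S` read as a `2 × 2` matrix, Alice and Bob hold the vector with amplitudes
`A * M_ψ * X k * M_φ * Bᵀ` (`amplitudes_localOperators`). Determinants multiply, and
`2 |det A| ≤ ‖A‖²` in the Hilbert–Schmidt norm, so the branch contributes at most
`‖A‖² ‖S‖² ‖B‖² / 16` times the product of the initial concurrences. Measurements preserve each of
the three squared norms on average (`sum_hsNormSq_mul`), and these start at `2`, `4`, `2` for the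
identities. Induction over the protocol (`LOCC.exists_hasEnsemble_output`) therefore gives the bound
for pure inputs; linearity of the protocol extends it to all ensembles of the two input states, and
taking infima gives the claim for the concurrence.

The ensembles of the output states constructed in this way also bound every convex roof of a
nonnegative function below the concurrence (`HasEnsemble.trace_mul_convexRoof_le`). The entropy of
entanglement is such a function, since the binary entropy of `x`, in bits, is at most
`2 √(x (1 - x))` (`binEntropy_le_two_mul_log_two_mul_sqrt`).
-/

/-! ### Binary entropy and the geometric mean -/

/-- On `(0, 1/2]` the quotient `binEntropy x / √(x (1 - x))` increases: the sign of its derivative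
is that of `(1 - x) log (1 - x) - x log x`, which is nonnegative because the secant slope of `log`
from `1` decreases. -/
theorem monotoneOn_binEntropy_div_sqrt :
    MonotoneOn (fun x : ℝ => Real.binEntropy x / √(x * (1 - x))) (Set.Ioc 0 (1 / 2)) := by
  have key : ∀ x ∈ Set.Ioo (0 : ℝ) (1 / 2),
      HasDerivAt (fun x : ℝ => Real.binEntropy x / √(x * (1 - x)))
        (((Real.log (1 - x) - Real.log x) * √(x * (1 - x)) -
          Real.binEntropy x * ((1 - 2 * x) / (2 * √(x * (1 - x))))) / √(x * (1 - x)) ^ 2) x := by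
    rintro x ⟨h0, h1⟩
    have hp : 0 < x * (1 - x) := mul_pos h0 (by linarith)
    have hq : HasDerivAt (fun x : ℝ => x * (1 - x)) (1 - 2 * x) x := by
      exact ((hasDerivAt_id' x).mul ((hasDerivAt_id' x).const_sub 1)).congr_deriv (by ring)
    exact (Real.hasDerivAt_binEntropy h0.ne' (by linarith)).div (hq.sqrt hp.ne')
      (Real.sqrt_pos.2 hp).ne'
  apply monotoneOn_of_deriv_nonneg (convex_Ioc _ _)
  · apply ContinuousOn.div
    · exact Real.binEntropy_continuous.continuousOn
    · fun_prop
    · rintro x ⟨h0, h1⟩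
      exact (Real.sqrt_pos.2 (mul_pos h0 (by linarith))).ne'
  · rw [interior_Ioc]
    exact fun x hx => (key x hx).differentiableAt.differentiableWithinAt
  · rw [interior_Ioc]
    intro x hx
    rw [(key x hx).deriv]
    obtain ⟨h0, h1⟩ := hx
    have hp : 0 < x * (1 - x) := mul_pos h0 (by linarith)
    have hs := Real.sqrt_pos.2 hp
    have hsq := Real.sq_sqrt hp.le
    have hlog : 0 ≤ (1 - x) * Real.log (1 - x) - x * Real.log x := by
      have h := strictConcaveOn_log_Ioi.secant_strict_mono (a := 1) (x := x) (y := 1 - x)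
        (by simp) (by simpa using h0) (by simp; linarith) (by linarith) (by linarith) (by linarith)
      rw [Real.log_one, sub_zero, sub_zero, div_lt_iff_of_neg (by linarith), div_mul_eq_mul_div,
        div_lt_iff_of_neg (by linarith)] at h
      linarith
    apply div_nonneg _ (sq_nonneg _)
    set s := √(x * (1 - x))
    have : (Real.log (1 - x) - Real.log x) * s - Real.binEntropy x * ((1 - 2 * x) / (2 * s)) =
        ((1 - x) * Real.log (1 - x) - x * Real.log x) / (2 * s) := by
      rw [Real.binEntropy_eq_negMulLog_add_negMulLog_one_sub, Real.negMulLog, Real.negMulLog]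
      field_simp
      rw [hsq]
      ring
    rw [this]
    positivity

/-- The two sides agree at `x = 0`, `x = 1/2` and `x = 1`. -/
theorem binEntropy_le_two_mul_log_two_mul_sqrt {x : ℝ} (h0 : 0 ≤ x) (h1 : x ≤ 1) :
    Real.binEntropy x ≤ 2 * Real.log 2 * √(x * (1 - x)) := by
  wlog h : x ≤ 1 / 2 generalizing x
  · have := this (x := 1 - x) (by linarith) (by linarith) (by linarith)
    rwa [Real.binEntropy_one_sub, sub_sub_cancel, mul_comm (1 - x)] at this
  rcases h0.eq_or_lt with rfl | h0
  · simp
  have hs := Real.sqrt_pos.2 (mul_pos h0 (by linarith : 0 < 1 - x))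
  have hm := monotoneOn_binEntropy_div_sqrt ⟨h0, h⟩ (⟨by norm_num, le_rfl⟩) h
  have h2 : √((1 / 2 : ℝ) * (1 - 1 / 2)) = 1 / 2 := by
    rw [Real.sqrt_eq_iff_mul_self_eq] <;> norm_num
  have h3 : Real.binEntropy (1 / 2) = Real.log 2 := by
    rw [one_div, Real.binEntropy_two_inv]
  simp only [h2, h3] at hm
  rw [div_le_iff₀ hs] at hm
  linarith

/-! ### Concurrence as a determinant -/

/-- The matrix of amplitudes of a two-qubit vector. -/
def amplitudes (ψ : Fin 2 × Fin 2 → ℂ) : Matrix (Fin 2) (Fin 2) ℂ :=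
  Matrix.of fun i k => ψ (i, k)

/-- The concurrence `2 |det|` of a two-qubit vector that need not be normalized; it is homogeneous
of degree two. -/
noncomputable def vectorConcurrence (ψ : Fin 2 × Fin 2 → ℂ) : ℝ :=
  2 * ‖(amplitudes ψ).det‖

theorem vectorConcurrence_nonneg (ψ : Fin 2 × Fin 2 → ℂ) : 0 ≤ vectorConcurrence ψ := by
  unfold vectorConcurrence; positivity

theorem vectorConcurrence_smul (c : ℂ) (ψ : Fin 2 × Fin 2 → ℂ) :
    vectorConcurrence (c • ψ) = ‖c‖ ^ 2 * vectorConcurrence ψ := by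
  have : amplitudes (c • ψ) = c • amplitudes ψ := rfl
  simp [vectorConcurrence, this]
  ring

theorem reducedOp_eq_mul_conjTranspose (ψ : Fin 2 × Fin 2 → ℂ) :
    reducedOp ψ = amplitudes ψ * (amplitudes ψ)ᴴ := by
  ext i j
  simp [reducedOp, amplitudes, Matrix.mul_apply]

theorem reducedOp_posSemidef (ψ : Fin 2 × Fin 2 → ℂ) : (reducedOp ψ).PosSemidef := by
  rw [reducedOp_eq_mul_conjTranspose]
  exact Matrix.posSemidef_self_mul_conjTranspose _

theorem det_reducedOp (ψ : Fin 2 × Fin 2 → ℂ) :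
    (reducedOp ψ).det = ((‖(amplitudes ψ).det‖ ^ 2 : ℝ) : ℂ) := by
  rw [reducedOp_eq_mul_conjTranspose, Matrix.det_mul, Matrix.det_conjTranspose]
  simp [Complex.mul_conj']

theorem trace_reducedOp {ψ : Fin 2 × Fin 2 → ℂ} (h : IsUnitVector ψ) :
    (reducedOp ψ).trace = 1 := by
  have h' : ((∑ x, ‖ψ x‖ ^ 2 : ℝ) : ℂ) = 1 := by rw [h]; simp
  rw [← h', Fintype.sum_prod_type]
  simp [Matrix.trace, reducedOp, Complex.mul_conj']

theorem pureConcurrence_eq_vectorConcurrence {ψ : Fin 2 × Fin 2 → ℂ} (h : IsUnitVector ψ) :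
    pureConcurrence ψ = vectorConcurrence ψ := by
  have ht := trace_reducedOp h
  have hd := det_reducedOp ψ
  -- Cayley–Hamilton: `Tr ρ² = (Tr ρ)² - 2 det ρ`
  have key : (reducedOp ψ * reducedOp ψ).trace =
      (reducedOp ψ).trace ^ 2 - 2 * (reducedOp ψ).det := by
    simp only [Matrix.trace_fin_two, Matrix.det_fin_two, Matrix.mul_apply, Fin.sum_univ_two]
    ring
  rw [ht, hd] at key
  have hre : ((reducedOp ψ * reducedOp ψ).trace).re = 1 - 2 * ‖(amplitudes ψ).det‖ ^ 2 := by
    rw [key, ← Complex.ofReal_one, ← Complex.ofReal_ofNat, ← Complex.ofReal_pow,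
      ← Complex.ofReal_mul, ← Complex.ofReal_sub, Complex.ofReal_re, one_pow]
  rw [pureConcurrence, hre, vectorConcurrence,
    show 2 * (1 - (1 - 2 * ‖(amplitudes ψ).det‖ ^ 2)) = (2 * ‖(amplitudes ψ).det‖) ^ 2 by ring]
  exact Real.sqrt_sq (by positivity)

theorem exists_pureEntanglement_eq_binEntropy {ψ : Fin 2 × Fin 2 → ℂ} (h : IsUnitVector ψ) :
    ∃ x : ℝ, 0 ≤ x ∧ x ≤ 1 ∧ x * (1 - x) = ‖(amplitudes ψ).det‖ ^ 2 ∧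
      pureEntanglement ψ = Real.binEntropy x / Real.log 2 := by
  set H := reducedOp_isHermitian ψ
  have hnn : ∀ i, 0 ≤ H.eigenvalues i := (reducedOp_posSemidef ψ).eigenvalues_nonneg
  have ht : H.eigenvalues 0 + H.eigenvalues 1 = 1 := by
    have := H.trace_eq_sum_eigenvalues
    rw [trace_reducedOp h, Fin.sum_univ_two] at this
    simpa using (congrArg Complex.re this).symm
  have hd : H.eigenvalues 0 * H.eigenvalues 1 = ‖(amplitudes ψ).det‖ ^ 2 := by
    have := H.det_eq_prod_eigenvalues
    rw [det_reducedOp, Fin.prod_univ_two] at this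
    have := congrArg Complex.re this
    simpa [-Complex.ofReal_pow] using this.symm
  have h1 : H.eigenvalues 1 = 1 - H.eigenvalues 0 := by linarith
  refine ⟨H.eigenvalues 0, hnn 0, by linarith [hnn 1], by rw [← h1, hd], ?_⟩
  rw [pureEntanglement, Fin.sum_univ_two, h1,
    ← Real.binEntropy_eq_negMulLog_add_negMulLog_one_sub]

theorem pureEntanglement_nonneg {ψ : Fin 2 × Fin 2 → ℂ} (h : IsUnitVector ψ) :
    0 ≤ pureEntanglement ψ := by
  obtain ⟨x, h0, h1, -, hE⟩ := exists_pureEntanglement_eq_binEntropy h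
  rw [hE]
  exact div_nonneg (Real.binEntropy_nonneg h0 h1) (Real.log_nonneg one_le_two)

/-- The entropy of entanglement of a pure state is at most its concurrence. -/
theorem pureEntanglement_le_vectorConcurrence {ψ : Fin 2 × Fin 2 → ℂ} (h : IsUnitVector ψ) :
    pureEntanglement ψ ≤ vectorConcurrence ψ := by
  obtain ⟨x, h0, h1, hx, hE⟩ := exists_pureEntanglement_eq_binEntropy h
  have := binEntropy_le_two_mul_log_two_mul_sqrt h0 h1
  rw [hx, Real.sqrt_sq (norm_nonneg _)] at this
  rw [hE, vectorConcurrence, div_le_iff₀ (Real.log_pos one_lt_two)]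
  linarith

/-! ### Ensembles of unnormalized vectors -/

/-- `HasEnsemble ω x` says that `ω = ∑ |vᵢ⟩⟨vᵢ|` for finitely many two-qubit vectors, normalized or
not, whose concurrences add up to `x`. Weights are absorbed into the vectors. -/
def HasEnsemble (ω : TwoQubitOp) (x : ℝ) : Prop :=
  ∃ (ι : Type) (_ : Fintype ι) (v : ι → Fin 2 × Fin 2 → ℂ),
    ω = ∑ i, Matrix.vecMulVec (v i) (star (v i)) ∧ x = ∑ i, vectorConcurrence (v i)

theorem HasEnsemble.zero : HasEnsemble 0 0 :=
  ⟨Empty, inferInstance, Empty.elim, by simp, by simp⟩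

theorem HasEnsemble.sum {κ : Type} [Fintype κ] {ω : κ → TwoQubitOp} {x : κ → ℝ}
    (h : ∀ k, HasEnsemble (ω k) (x k)) : HasEnsemble (∑ k, ω k) (∑ k, x k) := by
  choose ι hι v hω hx using h
  refine ⟨(k : κ) × ι k, inferInstance, fun i => v i.1 i.2, ?_, ?_⟩
  · simp only [Fintype.sum_sigma, ← hω]
  · simp only [Fintype.sum_sigma, ← hx]

theorem HasEnsemble.nonneg {ω : TwoQubitOp} {x : ℝ} (h : HasEnsemble ω x) : 0 ≤ x := by
  obtain ⟨ι, _, v, -, rfl⟩ := h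
  exact Finset.sum_nonneg fun i _ => vectorConcurrence_nonneg _

theorem vecMulVec_smul_star {n : Type*} (c : ℂ) (v : n → ℂ) :
    Matrix.vecMulVec (c • v) (star (c • v)) =
      ((‖c‖ ^ 2 : ℝ) : ℂ) • Matrix.vecMulVec v (star v) := by
  ext i j
  simp only [Matrix.vecMulVec_apply, Pi.smul_apply, Pi.star_apply, smul_eq_mul, star_mul',
    Matrix.smul_apply, Complex.ofReal_pow, ← Complex.mul_conj', RCLike.star_def]
  ring

theorem re_trace_vecMulVec_star (v : Fin 2 × Fin 2 → ℂ) :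
    (Matrix.vecMulVec v (star v)).trace.re = ∑ x, ‖v x‖ ^ 2 := by
  simp [Matrix.trace, Matrix.vecMulVec_apply, Complex.mul_conj', ← Complex.ofReal_pow]

theorem HasEnsemble.re_trace_nonneg {ω : TwoQubitOp} {x : ℝ} (h : HasEnsemble ω x) :
    0 ≤ ω.trace.re := by
  obtain ⟨ι, _, v, rfl, -⟩ := h
  rw [Matrix.trace_sum, Complex.re_sum]
  refine Finset.sum_nonneg fun i _ => ?_
  rw [re_trace_vecMulVec_star]
  positivity

theorem exists_isUnitVector_smul (v : Fin 2 × Fin 2 → ℂ) :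
    ∃ u, IsUnitVector u ∧ v = (√(∑ x, ‖v x‖ ^ 2) : ℂ) • u := by
  have hN : 0 ≤ ∑ x, ‖v x‖ ^ 2 := by positivity
  rcases hN.eq_or_lt with h | h
  · refine ⟨Pi.single 0 1, ?_, ?_⟩
    · simp [IsUnitVector, Fintype.sum_prod_type, Pi.single_apply]
    · have : ∀ x, v x = 0 := fun x => by
        have h0 := (Finset.sum_eq_zero_iff_of_nonneg fun x _ => by positivity).1 h.symm x
          (Finset.mem_univ x)
        simpa using h0
      ext x
      simp [← h, this x]
  · have hs := Real.sqrt_pos.2 h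
    refine ⟨(√(∑ x, ‖v x‖ ^ 2) : ℂ)⁻¹ • v, ?_, ?_⟩
    · simp only [IsUnitVector, Pi.smul_apply, norm_smul, mul_pow, ← Finset.mul_sum]
      rw [norm_inv, Complex.norm_real, Real.norm_of_nonneg hs.le, inv_pow, Real.sq_sqrt hN,
        inv_mul_cancel₀ h.ne']
    · rw [smul_inv_smul₀]
      exact_mod_cast hs.ne'

/-- Normalizing the vectors of an ensemble of `ω` gives a decomposition of `ω / Tr ω` into pure
states. -/
theorem HasEnsemble.exists_decomposition {ω : TwoQubitOp} {x : ℝ} (h : HasEnsemble ω x)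
    (hQ : 0 < ω.trace.re) :
    ∃ (n : ℕ) (p : Fin n → ℝ) (ψ : Fin n → Fin 2 × Fin 2 → ℂ),
      (∀ i, 0 ≤ p i) ∧ ∑ i, p i = 1 ∧ (∀ i, IsUnitVector (ψ i)) ∧
      ((ω.trace.re : ℂ))⁻¹ • ω = ∑ i, (p i : ℂ) • Matrix.vecMulVec (ψ i) (star (ψ i)) ∧
      ω.trace.re * ∑ i, p i * vectorConcurrence (ψ i) = x := by
  obtain ⟨ι, _, v, hω, rfl⟩ := h
  choose u hu hv using fun i => exists_isUnitVector_smul (v i)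
  have hN : ∀ i, 0 ≤ ∑ x, ‖v i x‖ ^ 2 := fun i => by positivity
  have hn : ∀ i, ‖(√(∑ x, ‖v i x‖ ^ 2) : ℂ)‖ ^ 2 = ∑ x, ‖v i x‖ ^ 2 := fun i => by
    rw [Complex.norm_real, Real.norm_of_nonneg (Real.sqrt_nonneg _), Real.sq_sqrt (hN i)]
  have ht : ω.trace.re = ∑ i, ∑ x, ‖v i x‖ ^ 2 := by
    rw [hω, Matrix.trace_sum, Complex.re_sum]
    exact Finset.sum_congr rfl fun i _ => re_trace_vecMulVec_star _
  have hvm : ∀ i, Matrix.vecMulVec (v i) (star (v i)) =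
      ((∑ x, ‖v i x‖ ^ 2 : ℝ) : ℂ) • Matrix.vecMulVec (u i) (star (u i)) := fun i => by
    conv_lhs => rw [hv i]
    rw [vecMulVec_smul_star, hn]
  have hc : ∀ i, vectorConcurrence (v i) = (∑ x, ‖v i x‖ ^ 2) * vectorConcurrence (u i) :=
    fun i => by
      conv_lhs => rw [hv i]
      rw [vectorConcurrence_smul, hn]
  generalize ω.trace.re = Q at *
  let e := (Fintype.equivFin ι).symm
  refine ⟨Fintype.card ι, fun i => (∑ x, ‖v (e i) x‖ ^ 2) / Q, fun i => u (e i),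
    fun i => div_nonneg (hN _) hQ.le, ?_, fun i => hu _, ?_, ?_⟩
  · rw [e.sum_comp (fun i => (∑ x, ‖v i x‖ ^ 2) / Q), ← Finset.sum_div, ← ht,
      div_self hQ.ne']
  · rw [e.sum_comp (fun i => (((∑ x, ‖v i x‖ ^ 2) / Q : ℝ) : ℂ) •
      Matrix.vecMulVec (u i) (star (u i))), hω, Finset.smul_sum]
    refine Finset.sum_congr rfl fun i _ => ?_
    rw [hvm, smul_smul, Complex.ofReal_div, div_eq_inv_mul]
  · rw [e.sum_comp (fun i => (∑ x, ‖v i x‖ ^ 2) / Q * vectorConcurrence (u i)), Finset.mul_sum]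
    refine Finset.sum_congr rfl fun i _ => ?_
    rw [hc]
    field_simp

/-- A convex roof of a function between zero and the concurrence is bounded by every ensemble. When
`Tr ω = 0` the state `ω / Tr ω` is a junk value, which has weight zero. -/
theorem HasEnsemble.trace_mul_convexRoof_le {ω : TwoQubitOp} {x : ℝ} (h : HasEnsemble ω x)
    {f : (Fin 2 × Fin 2 → ℂ) → ℝ} (hf0 : ∀ ψ, IsUnitVector ψ → 0 ≤ f ψ)
    (hf : ∀ ψ, IsUnitVector ψ → f ψ ≤ vectorConcurrence ψ) :
    ω.trace.re * convexRoof f (((ω.trace.re : ℂ))⁻¹ • ω) ≤ x := by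
  rcases h.re_trace_nonneg.eq_or_lt with hQ | hQ
  · rw [← hQ, zero_mul]; exact h.nonneg
  obtain ⟨n, p, ψ, hp, hp1, hψ, hω, hx⟩ := h.exists_decomposition hQ
  rw [← hx]
  refine mul_le_mul_of_nonneg_left ?_ hQ.le
  refine le_trans (b := ∑ i, p i * f (ψ i))
    (csInf_le ⟨0, ?_⟩ ⟨n, p, ψ, hp, hp1, hψ, hω, rfl⟩)
    (Finset.sum_le_sum fun i _ => mul_le_mul_of_nonneg_left (hf _ (hψ i)) (hp i))
  rintro _ ⟨n, p, ψ, hp, -, hψ, -, rfl⟩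
  exact Finset.sum_nonneg fun i _ => mul_nonneg (hp i) (hf0 _ (hψ i))

theorem IsTwoQubitState.exists_hasEnsemble {ρ : TwoQubitOp} (h : IsTwoQubitState ρ) :
    ∃ x, HasEnsemble ρ x := by
  obtain ⟨n, v, hv⟩ := Matrix.posSemidef_iff_eq_sum_vecMulVec.1 h.1
  exact ⟨_, Fin n, inferInstance, v, hv, rfl⟩

theorem le_concurrence_of_forall_hasEnsemble {ρ : TwoQubitOp} (h : IsTwoQubitState ρ) {c : ℝ}
    (hc : ∀ x, HasEnsemble ρ x → c ≤ x) : c ≤ concurrence ρ := by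
  have ht : ρ.trace.re = 1 := by rw [h.2, Complex.one_re]
  apply le_csInf
  · obtain ⟨x, hx⟩ := h.exists_hasEnsemble
    obtain ⟨n, p, ψ, hp, hp1, hψ, hρ, -⟩ := hx.exists_decomposition (by rw [ht]; exact one_pos)
    rw [ht, Complex.ofReal_one, inv_one, one_smul] at hρ
    exact ⟨_, n, p, ψ, hp, hp1, hψ, hρ, rfl⟩
  · rintro _ ⟨n, p, ψ, hp, -, hψ, hρ, rfl⟩
    have hn : ∀ i, ‖(√(p i) : ℂ)‖ ^ 2 = p i := fun i => by
      rw [Complex.norm_real, Real.norm_of_nonneg (Real.sqrt_nonneg _), Real.sq_sqrt (hp i)]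
    refine hc _ ⟨Fin n, inferInstance, fun i => (√(p i) : ℂ) • ψ i, ?_, ?_⟩
    · simp only [vecMulVec_smul_star, hn, hρ]
    · simp only [vectorConcurrence_smul, hn, pureConcurrence_eq_vectorConcurrence (hψ _)]

theorem le_concurrence_mul_concurrence {ρ τ : TwoQubitOp} (hρ : IsTwoQubitState ρ)
    (hτ : IsTwoQubitState τ) {c : ℝ}
    (hc : ∀ x y, HasEnsemble ρ x → HasEnsemble τ y → c ≤ x * y) :
    c ≤ concurrence ρ * concurrence τ := by
  have hρ0 : 0 ≤ concurrence ρ :=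
    le_concurrence_of_forall_hasEnsemble hρ fun _ hx => hx.nonneg
  have h1 : ∀ y, HasEnsemble τ y → c ≤ concurrence ρ * y := by
    intro y hy
    rcases hy.nonneg.eq_or_lt with h0 | h0
    · obtain ⟨x, hx⟩ := hρ.exists_hasEnsemble
      simpa [← h0] using hc x y hx hy
    · rw [← div_le_iff₀ h0]
      exact le_concurrence_of_forall_hasEnsemble hρ fun x hx => (div_le_iff₀ h0).2 (hc x y hx hy)
  rcases hρ0.eq_or_lt with h0 | h0
  · obtain ⟨y, hy⟩ := hτ.exists_hasEnsemble
    simpa [← h0] using h1 y hy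
  · rw [← div_le_iff₀' h0]
    exact le_concurrence_of_forall_hasEnsemble hτ fun y hy => (div_le_iff₀' h0).2 (h1 y hy)

/-! ### Protocols on pure product inputs -/

/-- The squared Hilbert–Schmidt norm. -/
noncomputable def hsNormSq {m n : Type*} [Fintype m] [Fintype n] (A : Matrix m n ℂ) : ℝ :=
  (Aᴴ * A).trace.re

theorem hsNormSq_eq_sum {m n : Type*} [Fintype m] [Fintype n] (A : Matrix m n ℂ) :
    hsNormSq A = ∑ i, ∑ j, ‖A i j‖ ^ 2 := by
  rw [Finset.sum_comm]
  simp [hsNormSq, Matrix.trace, Matrix.mul_apply, Complex.conj_mul', ← Complex.ofReal_pow]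

theorem hsNormSq_nonneg {m n : Type*} [Fintype m] [Fintype n] (A : Matrix m n ℂ) :
    0 ≤ hsNormSq A := by
  rw [hsNormSq_eq_sum]; positivity

/-- A measurement preserves the squared Hilbert–Schmidt norm on average. -/
theorem sum_hsNormSq_mul {l n p : Type*} [Fintype l] [DecidableEq l] [Fintype n] [Fintype p]
    {q : p → Type*} [∀ i, Fintype (q i)] (K : (i : p) → Matrix (q i) l ℂ)
    (hK : ∑ i, (K i)ᴴ * K i = 1) (A : Matrix l n ℂ) :
    ∑ i, hsNormSq (K i * A) = hsNormSq A := by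
  have : ∀ i, (K i * A)ᴴ * (K i * A) = Aᴴ * ((K i)ᴴ * K i) * A := fun i => by
    rw [Matrix.conjTranspose_mul]; simp only [Matrix.mul_assoc]
  simp only [hsNormSq, this]
  rw [← Complex.re_sum, ← Matrix.trace_sum, ← Matrix.sum_mul, ← Matrix.mul_sum, hK, Matrix.mul_one]

theorem two_mul_norm_det_le (A : Matrix (Fin 2) (Fin 2) ℂ) : 2 * ‖A.det‖ ≤ hsNormSq A := by
  rw [hsNormSq_eq_sum, Matrix.det_fin_two]
  simp only [Fin.sum_univ_two]
  have h := norm_sub_le (A 0 0 * A 1 1) (A 0 1 * A 1 0)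
  rw [norm_mul, norm_mul] at h
  nlinarith [sq_nonneg (‖A 0 0‖ - ‖A 1 1‖), sq_nonneg (‖A 0 1‖ - ‖A 1 0‖)]

/-- The joint vector `|ψ⟩₁₂ ⊗ |φ⟩₃₄`, with Sapna's two qubits merged into one system. -/
def jointVector (ψ φ : Fin 2 × Fin 2 → ℂ) : Fin 2 × Fin (2 * 2) × Fin 2 → ℂ := fun x =>
  ψ (x.1, (finProdFinEquiv.symm x.2.1).1) * φ ((finProdFinEquiv.symm x.2.1).2, x.2.2)

/-- A row of Sapna's operator, read as a `2 × 2` matrix between her two qubits. -/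
def sapnaRow {s : ℕ} (S : Matrix (Fin s) (Fin (2 * 2)) ℂ) (k : Fin s) :
    Matrix (Fin 2) (Fin 2) ℂ :=
  Matrix.of fun β γ => S k (finProdFinEquiv (β, γ))

theorem sum_hsNormSq_sapnaRow {s : ℕ} (S : Matrix (Fin s) (Fin (2 * 2)) ℂ) :
    ∑ k, hsNormSq (sapnaRow S k) = hsNormSq S := by
  rw [hsNormSq_eq_sum S]
  refine Finset.sum_congr rfl fun k _ => ?_
  rw [hsNormSq_eq_sum, ← Fintype.sum_prod_type', ← finProdFinEquiv.sum_comp]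
  rfl

/-- If Sapna's system is found in the basis state `k`, the amplitudes are a product of `2 × 2`
matrices. -/
theorem amplitudes_localOperators {s : ℕ} (A B : Matrix (Fin 2) (Fin 2) ℂ)
    (S : Matrix (Fin s) (Fin (2 * 2)) ℂ) (ψ φ : Fin 2 × Fin 2 → ℂ) (k : Fin s) :
    amplitudes (fun x => ((A ⊗ₖ (S ⊗ₖ B)) *ᵥ jointVector ψ φ) (x.1, k, x.2)) =
      A * amplitudes ψ * sapnaRow S k * amplitudes φ * Bᵀ := by
  have hsum : ∀ g : Fin (2 * 2) → ℂ, ∑ t, g t = ∑ β, ∑ γ, g (finProdFinEquiv (β, γ)) :=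
    fun g => by rw [← finProdFinEquiv.sum_comp, Fintype.sum_prod_type]
  ext i j
  simp only [amplitudes, sapnaRow, jointVector, Matrix.of_apply, Matrix.mulVec, dotProduct,
    Matrix.kroneckerMap_apply, Fintype.sum_prod_type, hsum, Equiv.symm_apply_apply,
    Matrix.mul_apply, Fin.sum_univ_two, Matrix.transpose_apply]
  ring

theorem traceSapna_vecMulVec {s : ℕ} (Ψ : Fin 2 × Fin s × Fin 2 → ℂ) :
    traceSapna (Matrix.vecMulVec Ψ (star Ψ)) =
      ∑ k, Matrix.vecMulVec (fun x : Fin 2 × Fin 2 => Ψ (x.1, k, x.2))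
        (star fun x : Fin 2 × Fin 2 => Ψ (x.1, k, x.2)) := by
  ext x y
  simp [traceSapna, Matrix.sum_apply, Matrix.vecMulVec_apply]

theorem mul_vecMulVec_star_mul_conjTranspose {m n : Type*} [Fintype n]
    (K : Matrix m n ℂ) (v : n → ℂ) :
    K * Matrix.vecMulVec v (star v) * Kᴴ = Matrix.vecMulVec (K *ᵥ v) (star (K *ᵥ v)) := by
  rw [Matrix.mul_vecMulVec, Matrix.vecMulVec_mul, Matrix.star_mulVec]

theorem two_mul_norm_det_mul_le {A X B M N : Matrix (Fin 2) (Fin 2) ℂ} :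
    2 * ‖(A * M * X * N * Bᵀ).det‖ ≤
      hsNormSq A * hsNormSq X * hsNormSq B / 16 * ((2 * ‖M.det‖) * (2 * ‖N.det‖)) := by
  have h : (2 * ‖A.det‖) * (2 * ‖X.det‖) * (2 * ‖B.det‖) ≤
      hsNormSq A * hsNormSq X * hsNormSq B := by
    gcongr <;> first | exact two_mul_norm_det_le _ | exact hsNormSq_nonneg _ | skip
    exact mul_nonneg (hsNormSq_nonneg _) (hsNormSq_nonneg _)
  have h' := mul_le_mul_of_nonneg_right h (by positivity : 0 ≤ ‖M.det‖ * ‖N.det‖)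
  simp only [Matrix.det_mul, Matrix.det_transpose, norm_mul]
  linarith

/-- By induction over the protocol: after the local operators `A`, `S`, `B` have acted on
`|ψ⟩ ⊗ |φ⟩`, the concurrence still to be produced is controlled by their Hilbert–Schmidt norms,
which measurements preserve on average. -/
theorem LOCC.exists_hasEnsemble_output {m : ℕ} (ψ φ : Fin 2 × Fin 2 → ℂ) {a s b : ℕ}
    (P : LOCC m a s b) (A : Matrix (Fin a) (Fin 2) ℂ) (S : Matrix (Fin s) (Fin (2 * 2)) ℂ)
    (B : Matrix (Fin b) (Fin 2) ℂ) :
    ∃ y : Fin m → ℝ,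
      (∀ j, HasEnsemble (P.output (Matrix.vecMulVec ((A ⊗ₖ (S ⊗ₖ B)) *ᵥ jointVector ψ φ)
        (star ((A ⊗ₖ (S ⊗ₖ B)) *ᵥ jointVector ψ φ))) j) (y j)) ∧
      ∑ j, y j ≤ hsNormSq A * hsNormSq S * hsNormSq B / 16 *
        (vectorConcurrence ψ * vectorConcurrence φ) := by
  induction P with
  | @done s j₀ =>
    let v : Fin s → Fin 2 × Fin 2 → ℂ := fun k x =>
      ((A ⊗ₖ (S ⊗ₖ B)) *ᵥ jointVector ψ φ) (x.1, k, x.2)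
    refine ⟨fun j => if j = j₀ then ∑ k, vectorConcurrence (v k) else 0, fun j => ?_, ?_⟩
    · simp only [LOCC.output]
      split_ifs
      · exact ⟨Fin s, inferInstance, v, traceSapna_vecMulVec _, rfl⟩
      · exact HasEnsemble.zero
    · rw [Finset.sum_ite_eq' Finset.univ j₀, if_pos (Finset.mem_univ _),
        ← sum_hsNormSq_sapnaRow S, Finset.mul_sum, Finset.sum_mul, Finset.sum_div, Finset.sum_mul]
      refine Finset.sum_le_sum fun k _ => ?_
      rw [vectorConcurrence, amplitudes_localOperators]
      exact two_mul_norm_det_mul_le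
  | alice n d K hK next ih =>
    choose y hy hle using fun i => ih i (K i * A) S B
    refine ⟨fun j => ∑ i, y i j, fun j => ?_, ?_⟩
    · simp only [LOCC.output, onAlice, mul_vecMulVec_star_mul_conjTranspose, Matrix.mulVec_mulVec,
        ← Matrix.mul_kronecker_mul, Matrix.one_mul]
      exact HasEnsemble.sum fun i => hy i j
    · rw [Finset.sum_comm]
      refine (Finset.sum_le_sum fun i _ => hle i).trans_eq ?_
      rw [← sum_hsNormSq_mul K hK A]
      simp only [Finset.sum_mul, Finset.sum_div]
  | sapna n d K hK next ih =>
    choose y hy hle using fun i => ih i A (K i * S) B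
    refine ⟨fun j => ∑ i, y i j, fun j => ?_, ?_⟩
    · simp only [LOCC.output, onSapna, mul_vecMulVec_star_mul_conjTranspose, Matrix.mulVec_mulVec,
        ← Matrix.mul_kronecker_mul, Matrix.one_mul]
      exact HasEnsemble.sum fun i => hy i j
    · rw [Finset.sum_comm]
      refine (Finset.sum_le_sum fun i _ => hle i).trans_eq ?_
      rw [← sum_hsNormSq_mul K hK S]
      simp only [Finset.mul_sum, Finset.sum_mul, Finset.sum_div]
  | bob n d K hK next ih =>
    choose y hy hle using fun i => ih i A S (K i * B)
    refine ⟨fun j => ∑ i, y i j, fun j => ?_, ?_⟩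
    · simp only [LOCC.output, onBob, mul_vecMulVec_star_mul_conjTranspose, Matrix.mulVec_mulVec,
        ← Matrix.mul_kronecker_mul, Matrix.one_mul]
      exact HasEnsemble.sum fun i => hy i j
    · rw [Finset.sum_comm]
      refine (Finset.sum_le_sum fun i _ => hle i).trans_eq ?_
      rw [← sum_hsNormSq_mul K hK B]
      simp only [Finset.mul_sum, Finset.sum_mul, Finset.sum_div]

/-! ### Mixed inputs -/

theorem LOCC.output_sum {m : ℕ} {κ : Type*} [Fintype κ] {a s b : ℕ} (P : LOCC m a s b)
    (ρ : κ → JointOp a s b) (j : Fin m) : P.output (∑ t, ρ t) j = ∑ t, P.output (ρ t) j := by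
  induction P with
  | done j₀ =>
    simp only [LOCC.output]
    split_ifs
    · ext x y
      simp only [traceSapna, Matrix.sum_apply, Matrix.of_apply]
      exact Finset.sum_comm
    · simp
  | alice n d K hK next ih =>
    simp only [LOCC.output, onAlice, Matrix.mul_sum, Matrix.sum_mul, ih]
    exact Finset.sum_comm
  | sapna n d K hK next ih =>
    simp only [LOCC.output, onSapna, Matrix.mul_sum, Matrix.sum_mul, ih]
    exact Finset.sum_comm
  | bob n d K hK next ih =>
    simp only [LOCC.output, onBob, Matrix.mul_sum, Matrix.sum_mul, ih]
    exact Finset.sum_comm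

theorem initialState_sum {ι κ : Type*} [Fintype ι] [Fintype κ] (v : ι → Fin 2 × Fin 2 → ℂ)
    (w : κ → Fin 2 × Fin 2 → ℂ) :
    initialState (∑ i, Matrix.vecMulVec (v i) (star (v i)))
        (∑ k, Matrix.vecMulVec (w k) (star (w k))) =
      ∑ t : ι × κ, Matrix.vecMulVec (jointVector (v t.1) (w t.2))
        (star (jointVector (v t.1) (w t.2))) := by
  ext x y
  simp only [initialState, Matrix.of_apply, Matrix.sum_apply, Matrix.vecMulVec_apply,
    Finset.sum_mul_sum, Fintype.sum_prod_type, jointVector, Pi.star_apply, star_mul']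
  refine Finset.sum_congr rfl fun i _ => Finset.sum_congr rfl fun k _ => ?_
  ring

theorem LOCC.exists_hasEnsemble_output_initialState {ρ₁₂ ρ₃₄ : TwoQubitOp} {x y : ℝ}
    (hx : HasEnsemble ρ₁₂ x) (hy : HasEnsemble ρ₃₄ y) {m : ℕ} (P : LOCC m 2 (2 * 2) 2) :
    ∃ z : Fin m → ℝ, (∀ j, HasEnsemble (P.output (initialState ρ₁₂ ρ₃₄) j) (z j)) ∧
      ∑ j, z j ≤ x * y := by
  obtain ⟨ι, _, v, rfl, rfl⟩ := hx
  obtain ⟨κ, _, w, rfl, rfl⟩ := hy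
  choose z hz hle using fun t : ι × κ => P.exists_hasEnsemble_output (v t.1) (w t.2) 1 1 1
  refine ⟨fun j => ∑ t, z t j, fun j => ?_, ?_⟩
  · simp only [Matrix.one_kronecker_one, Matrix.one_mulVec] at hz
    rw [initialState_sum, LOCC.output_sum]
    exact HasEnsemble.sum fun t => hz t j
  · rw [Finset.sum_comm, Finset.sum_mul_sum,
      ← Fintype.sum_prod_type' fun i k => vectorConcurrence (v i) * vectorConcurrence (w k)]
    refine Finset.sum_le_sum fun t _ => (hle t).trans_eq ?_
    -- the identities have squared norms `2`, `4`, `2`, which cancel the factor `1 / 16`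
    norm_num [hsNormSq]

theorem LOCC.sum_prob_mul_convexRoof_le {ρ₁₂ ρ₃₄ : TwoQubitOp} (h₁₂ : IsTwoQubitState ρ₁₂)
    (h₃₄ : IsTwoQubitState ρ₃₄) {m : ℕ} (P : LOCC m 2 (2 * 2) 2)
    {f : (Fin 2 × Fin 2 → ℂ) → ℝ} (hf0 : ∀ ψ, IsUnitVector ψ → 0 ≤ f ψ)
    (hf : ∀ ψ, IsUnitVector ψ → f ψ ≤ vectorConcurrence ψ) :
    ∑ j, P.prob (initialState ρ₁₂ ρ₃₄) j * convexRoof f (P.outcome (initialState ρ₁₂ ρ₃₄) j) ≤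
      concurrence ρ₁₂ * concurrence ρ₃₄ := by
  refine le_concurrence_mul_concurrence h₁₂ h₃₄ fun x y hx hy => ?_
  obtain ⟨z, hz, hle⟩ := P.exists_hasEnsemble_output_initialState hx hy
  exact (Finset.sum_le_sum fun j _ => (hz j).trace_mul_convexRoof_le hf0 hf).trans hle

theorem theorem1 (ρ₁₂ ρ₃₄ : TwoQubitOp) (h₁₂ : IsTwoQubitState ρ₁₂) (h₃₄ : IsTwoQubitState ρ₃₄)
    (m : ℕ) (P : LOCC m 2 (2 * 2) 2) :
    ∑ j, P.prob (initialState ρ₁₂ ρ₃₄) j * concurrence (P.outcome (initialState ρ₁₂ ρ₃₄) j)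
        ≤ concurrence ρ₁₂ * concurrence ρ₃₄ ∧
    ∑ j, P.prob (initialState ρ₁₂ ρ₃₄) j *
          entanglementOfFormation (P.outcome (initialState ρ₁₂ ρ₃₄) j)
        ≤ concurrence ρ₁₂ * concurrence ρ₃₄ := by
  refine ⟨P.sum_prob_mul_convexRoof_le h₁₂ h₃₄ (fun _ _ => Real.sqrt_nonneg _) fun _ hψ =>
      (pureConcurrence_eq_vectorConcurrence hψ).le,
    P.sum_prob_mul_convexRoof_le h₁₂ h₃₄ (fun _ => pureEntanglement_nonneg) fun _ =>
      pureEntanglement_le_vectorConcurrence⟩
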